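/- Let $n\ge 1$, let $Q$ be a real symmetric $n\times n$ matrix, let $e\in\mathbb{R}^n$ be the all-ones vector and $\Delta=\{x\in\mathbb{R}^n: x\ge 0,\ e^Tx=1\}$ the standard simplex. Consider the following two bounds for the standard quadratic program $\min\{x^TQx : x\in\Delta\}$. (a) Level $1$ of Parrilo's hierarchy: $p^1_Q=\max\{\ell\in\mathbb{R} : Q-\ell ee^T\in\mathcal{P}^1\}$, where $\mathcal{P}^r$ is the set of real symmetric $n\times n$ matrices $A$ such that the polynomial $\left(\sum_{i=1}^n x_i^2\right)^r\sum_{i,j=1}^n x_i^2A_{ij}x_j^2$ is a sum of squares of real polynomials. (b) The cubic bound (BSQ): the maximum of $\ell\in\mathbb{R}$ over all $\ell$, $\alpha_1,\dots,\alpha_{n+1}$ and $\kappa$ such that $$x^TQx-\ell-\sum_{i=1}^n\alpha_i(x)x_i+\alpha_{n+1}(x)(e^Tx-1)-\kappa(x)$$ is a quadratic function that is nonnegative on $\mathbb{R}^n$, where $\alpha_1,\dots,\alpha_n$ are convex quadratic functions on $\mathbb{R}^n$ that are nonnegative on $\Delta$, $\alpha_{n+1}$ is an arbitrary quadratic function on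 $\mathbb{R}^n$, and $\kappa$ is a polynomial of degree at most three with nonnegative coefficients. (A quadratic function is a polynomial of degree at most two.) Then both maxima exist (they are finite and attained), and they are equal: $p^1_Q$ equals the optimal value of (BSQ). -/

import Mathlib

open scoped BigOperators

namespace StQP

/-- The polynomial `xᵀ A x` in the variables `x₁, …, xₙ`. -/
noncomputable def quadForm {n : ℕ} (A : Matrix (Fin n) (Fin n) ℝ) : MvPolynomial (Fin n) ℝ :=
  ∑ i, ∑ j, MvPolynomial.C (A i j) * MvPolynomial.X i * MvPolynomial.X j

/-- Quadratic functions on `ℝⁿ`: polynomials of degree at most two. -/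
def quadratics (n : ℕ) : Set (MvPolynomial (Fin n) ℝ) :=
  {q | q.totalDegree ≤ 2}

/-- Quadratic functions that are nonnegative on `X`. -/
def nonnegQuadratics {n : ℕ} (X : Set (Fin n → ℝ)) : Set (MvPolynomial (Fin n) ℝ) :=
  {q | q ∈ quadratics n ∧ ∀ x ∈ X, 0 ≤ MvPolynomial.eval x q}

/-- Convex quadratic functions on `ℝⁿ` that are nonnegative on `X`. -/
def convexNonnegQuadratics {n : ℕ} (X : Set (Fin n → ℝ)) : Set (MvPolynomial (Fin n) ℝ) :=
  {q | q ∈ nonnegQuadratics X ∧ ConvexOn ℝ Set.univ (fun x => MvPolynomial.eval x q)}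

/-- Cubic functions (polynomials of degree at most three) with nonnegative coefficients. -/
def nonnegCoeffCubics (n : ℕ) : Set (MvPolynomial (Fin n) ℝ) :=
  {κ | κ.totalDegree ≤ 3 ∧ ∀ m, 0 ≤ κ.coeff m}

/-- Parrilo's cone of level `r`: the symmetric matrices `A` for which
`(∑ xᵢ²)ʳ (∑ xᵢ² Aᵢⱼ xⱼ²)` is a sum of squares of polynomials. -/
def parriloCone (n r : ℕ) : Set (Matrix (Fin n) (Fin n) ℝ) :=
  {A | A.IsSymm ∧
    IsSumSq ((∑ i, (MvPolynomial.X i : MvPolynomial (Fin n) ℝ) ^ 2) ^ r *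
      ∑ i, ∑ j, MvPolynomial.X i ^ 2 * MvPolynomial.C (A i j) * MvPolynomial.X j ^ 2)}

/-- The feasible values `ℓ` of Parrilo's problem of level `r`: `Q - ℓ e eᵀ` lies in the cone. -/
def parriloFeasible {n : ℕ} (r : ℕ) (Q : Matrix (Fin n) (Fin n) ℝ) : Set ℝ :=
  {l | Q - l • Matrix.vecMulVec 1 1 ∈ parriloCone n r}

/-- The level `r` bound of Parrilo's hierarchy. -/
noncomputable def parriloBound {n : ℕ} (r : ℕ) (Q : Matrix (Fin n) (Fin n) ℝ) : ℝ :=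
  sSup (parriloFeasible r Q)

/-- The feasible values `ℓ` of the cubic bound: there are multipliers `α₁, …, αₙ` (convex
quadratic, nonnegative on the standard simplex), `β` (an arbitrary quadratic) and `κ` (a cubic with
nonnegative coefficients) such that
`xᵀQx - ℓ - ∑ αᵢ(x) xᵢ + β(x) (eᵀx - 1) - κ(x)` is a quadratic function nonnegative on `ℝⁿ`. -/
def cubicFeasible {n : ℕ} (Q : Matrix (Fin n) (Fin n) ℝ) : Set ℝ :=
  {l | ∃ (α : Fin n → MvPolynomial (Fin n) ℝ) (β κ : MvPolynomial (Fin n) ℝ),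
    (∀ i, α i ∈ convexNonnegQuadratics (stdSimplex ℝ (Fin n))) ∧
    β ∈ quadratics n ∧
    κ ∈ nonnegCoeffCubics n ∧
    quadForm Q - MvPolynomial.C l - ∑ i, α i * MvPolynomial.X i
      + β * (∑ i, MvPolynomial.X i - 1) - κ ∈ nonnegQuadratics Set.univ}

/-- The cubic bound. -/
noncomputable def cubicBound {n : ℕ} (Q : Matrix (Fin n) (Fin n) ℝ) : ℝ :=
  sSup (cubicFeasible Q)

end StQP

namespace StQP

open Matrix

/-! Both feasible sets coincide with one intermediate set, `certFeasible Q`. With s = ∑ yᵢ, it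
contains `l` when s (yᵀQy - l s²) agrees on the orthant with a cubic form ∑ yᵢ yᵀPᵢy + ∑ cᵢⱼₖ
yᵢyⱼyₖ, Pᵢ ⪰ 0, c ≥ 0.

Parrilo side (`parriloFeasible_one_eq`): put yᵢ = xᵢ². Squares of cubic forms in x summing to a form
in the xᵢ² may be averaged over all sign changes of x, which removes cross terms between monomials
of different parity pattern. A cubic monomial has one or three variables of odd exponent, so the
surviving squares are yᵢ (aᵀy)² or a nonnegative multiple of yᵢyⱼyₖ. Conversely, substituting
squares in a certificate gives a sum of squares.

Cubic side (`cubicFeasible_eq`): on the hyperplane eᵀx = 1 the β term vanishes, and x = y / s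
homogenizes the rest. A convex quadratic nonnegative on the simplex is, on that hyperplane, a
nonnegative constant plus a nonnegative linear form plus a positive semidefinite form in x - z, so
its homogenization is compatible with certificates (`exists_simplex_decomposition`). Conversely a
certificate supplies the multipliers, with zero remainder.

The maximum is attained since certificates with `l` bounded below form a compact set
(`isCompact_certParams`). -/

/-- The cubic form `∑ yᵢ yᵀ Pᵢ y + ∑ cᵢⱼₖ yᵢ yⱼ yₖ`. -/
def cubicForm {n : ℕ} (P : Fin n → Matrix (Fin n) (Fin n) ℝ) (c : Fin n → Fin n → Fin n → ℝ)
    (y : Fin n → ℝ) : ℝ :=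
  ∑ i, y i * (y ⬝ᵥ P i *ᵥ y) + ∑ i, ∑ j, ∑ k, c i j k * (y i * y j * y k)

/-- Functions that agree on the nonnegative orthant with a cubic form
`∑ yᵢ yᵀ Pᵢ y + ∑ cᵢⱼₖ yᵢ yⱼ yₖ`, where the `Pᵢ` are positive semidefinite and `c ≥ 0`. -/
def IsCert {n : ℕ} (g : (Fin n → ℝ) → ℝ) : Prop :=
  ∃ (P : Fin n → Matrix (Fin n) (Fin n) ℝ) (c : Fin n → Fin n → Fin n → ℝ),
    (∀ i, (P i).PosSemidef) ∧ (∀ i j k, 0 ≤ c i j k) ∧ ∀ y, 0 ≤ y → g y = cubicForm P c y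

lemma posSemidef_iff_real {n : ℕ} {A : Matrix (Fin n) (Fin n) ℝ} :
    A.PosSemidef ↔ A.IsSymm ∧ ∀ v : Fin n → ℝ, 0 ≤ v ⬝ᵥ A *ᵥ v := by
  rw [posSemidef_iff_dotProduct_mulVec]
  simp [Matrix.IsHermitian, Matrix.IsSymm]

lemma _root_.Matrix.PosSemidef.dotProduct_nonneg {n : ℕ} {A : Matrix (Fin n) (Fin n) ℝ}
    (hA : A.PosSemidef) (v : Fin n → ℝ) : 0 ≤ v ⬝ᵥ A *ᵥ v :=
  (posSemidef_iff_real.1 hA).2 v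

/-! ### The convex cone of certificates and its generators -/

lemma IsCert.congr {n : ℕ} {g h : (Fin n → ℝ) → ℝ} (hg : IsCert g)
    (hgh : ∀ y, 0 ≤ y → h y = g y) : IsCert h := by
  obtain ⟨P, c, hP, hc, H⟩ := hg
  exact ⟨P, c, hP, hc, fun y hy => (hgh y hy).trans (H y hy)⟩

lemma IsCert.zero {n : ℕ} : IsCert (fun _ : Fin n → ℝ => 0) :=
  ⟨0, 0, fun _ => PosSemidef.zero, fun _ _ _ => le_rfl, fun y _ => by simp [cubicForm]⟩

lemma IsCert.add {n : ℕ} {g h : (Fin n → ℝ) → ℝ} (hg : IsCert g) (hh : IsCert h) :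
    IsCert (fun y => g y + h y) := by
  obtain ⟨P, c, hP, hc, H⟩ := hg
  obtain ⟨P', c', hP', hc', H'⟩ := hh
  refine ⟨P + P', c + c', fun i => (hP i).add (hP' i),
    fun i j k => add_nonneg (hc i j k) (hc' i j k), fun y hy => ?_⟩
  simp only [H y hy, H' y hy, cubicForm, Pi.add_apply, add_mulVec, dotProduct_add, mul_add,
    add_mul, Finset.sum_add_distrib]
  ring

lemma IsCert.sum {n : ℕ} {ι : Type*} (s : Finset ι) {g : ι → (Fin n → ℝ) → ℝ}
    (hg : ∀ i ∈ s, IsCert (g i)) : IsCert (fun y => ∑ i ∈ s, g i y) := by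
  classical
  induction s using Finset.induction_on with
  | empty => simpa using IsCert.zero
  | insert a s ha ih =>
    simp only [Finset.sum_insert ha]
    exact (hg a (Finset.mem_insert_self a s)).add
      (ih fun i hi => hg i (Finset.mem_insert_of_mem hi))

lemma isCert_mul_of_posSemidef {n : ℕ} {P : Matrix (Fin n) (Fin n) ℝ} (hP : P.PosSemidef)
    (i : Fin n) : IsCert (fun y => y i * (y ⬝ᵥ P *ᵥ y)) := by
  refine ⟨Pi.single i P, 0, fun j => ?_, fun _ _ _ => le_rfl, fun y _ => ?_⟩
  · rcases eq_or_ne j i with rfl | h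
    · simpa using hP
    · simpa [h] using PosSemidef.zero
  · rw [cubicForm, Finset.sum_eq_single i]
    · simp
    · intro j _ h
      simp [h]
    · simp

lemma dotProduct_vecMulVec_mulVec {n : ℕ} (a b y : Fin n → ℝ) :
    y ⬝ᵥ vecMulVec a b *ᵥ y = (a ⬝ᵥ y) * (b ⬝ᵥ y) := by
  rw [vecMulVec_mulVec, op_smul_eq_smul, dotProduct_smul, smul_eq_mul, dotProduct_comm y, mul_comm]

lemma isCert_mul_sq {n : ℕ} (i : Fin n) (a : Fin n → ℝ) :
    IsCert (fun y => y i * (a ⬝ᵥ y) ^ 2) := by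
  refine (isCert_mul_of_posSemidef (posSemidef_vecMulVec_self_star a) i).congr fun y _ => ?_
  rw [dotProduct_vecMulVec_mulVec, star_trivial, sq]

lemma isCert_linear_mul {n : ℕ} {a b d : Fin n → ℝ} (ha : 0 ≤ a) (hb : 0 ≤ b) (hd : 0 ≤ d) :
    IsCert (fun y => (a ⬝ᵥ y) * (b ⬝ᵥ y) * (d ⬝ᵥ y)) := by
  refine ⟨0, fun i j k => a k * b j * d i, fun _ => PosSemidef.zero,
    fun i j k => mul_nonneg (mul_nonneg (ha k) (hb j)) (hd i), fun y _ => ?_⟩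
  simp only [cubicForm, dotProduct, Finset.sum_mul, Finset.mul_sum]
  simp only [Pi.zero_apply, zero_mulVec, mul_zero, Finset.sum_const_zero, zero_add]
  exact Finset.sum_congr rfl fun i _ => Finset.sum_congr rfl fun j _ =>
    Finset.sum_congr rfl fun k _ => by ring

lemma IsCert.const_mul {n : ℕ} {g : (Fin n → ℝ) → ℝ} (hg : IsCert g) {r : ℝ} (hr : 0 ≤ r) :
    IsCert (fun y => r * g y) := by
  obtain ⟨P, c, hP, hc, H⟩ := hg
  refine ⟨r • P, r • c, fun i => (hP i).smul hr, fun i j k => mul_nonneg hr (hc i j k),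
    fun y hy => ?_⟩
  simp only [H y hy, cubicForm, Pi.smul_apply, smul_mulVec, dotProduct_smul, smul_eq_mul, mul_add,
    Finset.mul_sum]
  congr 1
  · exact Finset.sum_congr rfl fun i _ => by ring
  · exact Finset.sum_congr rfl fun i _ => Finset.sum_congr rfl fun j _ =>
      Finset.sum_congr rfl fun k _ => by ring

/-- The values `l` for which `(∑ yᵢ) (yᵀ Q y - l (∑ yᵢ)²)` has a certificate. -/
def certFeasible {n : ℕ} (Q : Matrix (Fin n) (Fin n) ℝ) : Set ℝ :=
  {l | IsCert (fun y => (∑ i, y i) * (y ⬝ᵥ Q *ᵥ y - l * (∑ i, y i) ^ 2))}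

lemma eval_quadForm {n : ℕ} (A : Matrix (Fin n) (Fin n) ℝ) (y : Fin n → ℝ) :
    MvPolynomial.eval y (quadForm A) = y ⬝ᵥ A *ᵥ y := by
  simp only [quadForm, map_sum, map_mul, MvPolynomial.eval_C, MvPolynomial.eval_X, dotProduct,
    mulVec, Finset.mul_sum]
  exact Finset.sum_congr rfl fun i _ => Finset.sum_congr rfl fun j _ => by ring

lemma toMultiset_eq_three {n : ℕ} {m : Fin n →₀ ℕ} {i j k : Fin n}
    (h : Finsupp.toMultiset m = {i, j, k}) :
    m = Finsupp.single i 1 + Finsupp.single j 1 + Finsupp.single k 1 := by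
  apply Multiset.toFinsupp.symm.injective
  change Finsupp.toMultiset m = Finsupp.toMultiset _
  simp [h, ← Multiset.singleton_add, add_assoc]

lemma prod_pow_eq_toMultiset {n : ℕ} (m : Fin n →₀ ℕ) (y : Fin n → ℝ) :
    ∏ i, y i ^ m i = ((Finsupp.toMultiset m).map y).prod := by
  rw [Finsupp.toMultiset_map, Finsupp.prod_toMultiset, Finsupp.prod_mapDomain_index, Finsupp.prod_pow]
  · simp
  · intros; exact pow_add _ _ _

/-! ### Homogeneity of the summands in a sum of squares -/

/-- The bound at 0 forces a root there. For t ≠ 0 it can be divided by t², and density extends the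
result to t = 0. -/
lemma exists_eq_X_mul_of_sq_eval_le {p : Polynomial ℝ} {C : ℝ} {k : ℕ}
    (h : ∀ t, p.eval t ^ 2 ≤ C * t ^ (2 * (k + 1))) :
    ∃ q : Polynomial ℝ, p = Polynomial.X * q ∧ ∀ t, q.eval t ^ 2 ≤ C * t ^ (2 * k) := by
  have h0 : p.eval 0 = 0 := by
    have := h 0
    rw [zero_pow (by omega), mul_zero] at this
    exact pow_eq_zero_iff (two_ne_zero) |>.1 (le_antisymm this (sq_nonneg _))
  obtain ⟨q, rfl⟩ := (Polynomial.X_dvd_iff (f := p)).2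
    (by rwa [Polynomial.coeff_zero_eq_eval_zero])
  refine ⟨q, rfl, fun t => ?_⟩
  have hcl : IsClosed {t : ℝ | q.eval t ^ 2 ≤ C * t ^ (2 * k)} :=
    isClosed_le (q.continuous.pow 2) (by fun_prop)
  have hsub : ({0}ᶜ : Set ℝ) ⊆ {t : ℝ | q.eval t ^ 2 ≤ C * t ^ (2 * k)} := by
    intro t ht
    have ht2 : 0 < t ^ 2 := by
      have : t ≠ 0 := ht
      positivity
    have := h t
    rw [Polynomial.eval_mul, Polynomial.eval_X, mul_pow, mul_add, pow_add, mul_one,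
      ← mul_assoc, mul_comm (t ^ 2)] at this
    exact le_of_mul_le_mul_right this ht2
  exact closure_minimal hsub hcl ((dense_compl_singleton (0 : ℝ)).closure_eq ▸ Set.mem_univ t)

/-- Three factors X split off, and the remaining cofactor is bounded, hence constant. -/
lemma coeff_eq_zero_of_sq_eval_le {p : Polynomial ℝ} {C : ℝ}
    (h : ∀ t, p.eval t ^ 2 ≤ C * t ^ 6) {d : ℕ} (hd : d ≠ 3) : p.coeff d = 0 := by
  obtain ⟨q, rfl, hq⟩ := exists_eq_X_mul_of_sq_eval_le (k := 2) h
  obtain ⟨r, rfl, hr⟩ := exists_eq_X_mul_of_sq_eval_le (k := 1) hq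
  obtain ⟨s, rfl, hs⟩ := exists_eq_X_mul_of_sq_eval_le (k := 0) hr
  have hdeg : s.degree ≤ 0 := by
    refine (Polynomial.isBoundedUnder_abs_atTop_iff s).1 ?_
    refine Filter.isBoundedUnder_of ⟨Real.sqrt C, fun t => ?_⟩
    exact Real.abs_le_sqrt (by simpa using hs t)
  rw [Polynomial.eq_C_of_degree_le_zero hdeg,
    show (Polynomial.X * (Polynomial.X * (Polynomial.X * Polynomial.C (s.coeff 0)))) =
      Polynomial.C (s.coeff 0) * Polynomial.X ^ 3 by ring, Polynomial.coeff_C_mul_X_pow, if_neg hd]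

lemma eval_smul_of_isHomogeneous {n d : ℕ} {φ : MvPolynomial (Fin n) ℝ} (hφ : φ.IsHomogeneous d)
    (t : ℝ) (x : Fin n → ℝ) : MvPolynomial.eval (t • x) φ = t ^ d * MvPolynomial.eval x φ := by
  rw [MvPolynomial.eval_eq', MvPolynomial.eval_eq', Finset.mul_sum]
  refine Finset.sum_congr rfl fun m hm => ?_
  have : ∑ i, m i = d := by
    rw [← Finsupp.degree_eq_sum, Finsupp.degree_eq_weight_one]
    exact hφ (MvPolynomial.mem_support_iff.1 hm)
  simp only [Pi.smul_apply, smul_eq_mul, mul_pow, Finset.prod_mul_distrib,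
    Finset.prod_pow_eq_pow_sum, this]
  ring

/-- Along the line t ↦ t x, `h` is a univariate polynomial whose coefficients are its homogeneous
components at x; the sextic bound leaves only degree 3. -/
lemma isHomogeneous_three_of_sq_eval_le {n : ℕ} {h : MvPolynomial (Fin n) ℝ}
    {F : (Fin n → ℝ) → ℝ} (hF : ∀ (t : ℝ) x, F (t • x) = t ^ 6 * F x)
    (hh : ∀ x, MvPolynomial.eval x h ^ 2 ≤ F x) : h.IsHomogeneous 3 := by
  have key : ∀ d, d ≠ 3 → MvPolynomial.homogeneousComponent d h = 0 := by
    intro d hd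
    rcases lt_or_ge h.totalDegree d with hlt | hle
    · exact MvPolynomial.homogeneousComponent_eq_zero _ _ hlt
    refine MvPolynomial.funext fun x => ?_
    let p : Polynomial ℝ := ∑ e ∈ Finset.range (h.totalDegree + 1),
      Polynomial.C (MvPolynomial.eval x (MvPolynomial.homogeneousComponent e h)) * Polynomial.X ^ e
    have hp : ∀ t, p.eval t = MvPolynomial.eval (t • x) h := by
      intro t
      refine Eq.trans ?_ (congrArg (MvPolynomial.eval (t • x))
        (MvPolynomial.sum_homogeneousComponent h))
      rw [map_sum, Polynomial.eval_finsetSum]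
      refine Finset.sum_congr rfl fun e _ => ?_
      rw [eval_smul_of_isHomogeneous (MvPolynomial.homogeneousComponent_isHomogeneous e h),
        Polynomial.eval_mul, Polynomial.eval_C, Polynomial.eval_pow, Polynomial.eval_X, mul_comm]
    have := coeff_eq_zero_of_sq_eval_le (p := p) (C := F x)
      (fun t => by rw [hp, mul_comm, ← hF]; exact hh _) hd
    simp only [p, Polynomial.finsetSum_coeff, Polynomial.coeff_C_mul_X_pow] at this
    rw [Finset.sum_ite_eq, if_pos (Finset.mem_range.2 (Nat.lt_succ_of_le hle))] at this
    simpa using this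
  intro m hm
  by_contra hne
  apply hm
  have := congrArg (MvPolynomial.coeff m) (key m.degree
    (by rwa [Finsupp.degree_eq_weight_one]))
  simpa [MvPolynomial.coeff_homogeneousComponent] using this

/-! ### Parity classes and averaging over signs -/

/-- The variables that occur to an odd power. -/
def oddSet {n : ℕ} (m : Fin n →₀ ℕ) : Finset (Fin n) := Finset.univ.filter fun i => Odd (m i)

/-- The sign encoded by a Boolean. -/
def sgn (b : Bool) : ℝ := cond b (-1) 1

lemma sgn_sq (b : Bool) : sgn b ^ 2 = 1 := by cases b <;> simp [sgn]

/-- Orthogonality of the characters of {±1}ⁿ: the character of a monomial depends only on its odd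
set. -/
lemma sum_prod_sgn_pow {n : ℕ} (m m' : Fin n →₀ ℕ) :
    ∑ ε : Fin n → Bool, (∏ i, sgn (ε i) ^ m i) * ∏ i, sgn (ε i) ^ m' i =
      if oddSet m = oddSet m' then 2 ^ n else 0 := by
  have h1 : ∑ ε : Fin n → Bool, (∏ i, sgn (ε i) ^ m i) * ∏ i, sgn (ε i) ^ m' i =
      ∏ i, ∑ b : Bool, sgn b ^ (m i + m' i) := by
    rw [Finset.prod_univ_sum, Fintype.piFinset_univ]
    exact Finset.sum_congr rfl fun ε _ => by
      rw [← Finset.prod_mul_distrib]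
      exact Finset.prod_congr rfl fun i _ => (pow_add _ _ _).symm
  rw [h1]
  split_ifs with h
  · have : ∀ i, ∑ b : Bool, sgn b ^ (m i + m' i) = 2 := by
      intro i
      have hi : Odd (m i) ↔ Odd (m' i) := by
        simpa [oddSet] using (Finset.ext_iff.1 h i)
      have : Even (m i + m' i) := by
        rw [Nat.even_add, ← Nat.not_odd_iff_even, ← Nat.not_odd_iff_even, hi]
      simp only [Fintype.univ_bool, sgn, Finset.mem_singleton, Bool.true_eq_false,
        not_false_eq_true, Finset.sum_insert, cond_true, this.neg_pow, one_pow,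
        Finset.sum_singleton, cond_false]
      norm_num
    simp only [this, Finset.prod_const, Finset.card_univ, Fintype.card_fin]
  · obtain ⟨i, hi⟩ : ∃ i, ¬ (Odd (m i) ↔ Odd (m' i)) := by
      by_contra! hc
      exact h (by ext i; simpa [oddSet] using hc i)
    refine Finset.prod_eq_zero (Finset.mem_univ i) ?_
    have : Odd (m i + m' i) := by
      rw [← Nat.not_even_iff_odd, Nat.even_add, ← Nat.not_odd_iff_even, ← Nat.not_odd_iff_even]
      tauto
    simp [sgn, this.neg_pow]

/-- Parseval's identity on {±1}ⁿ, with monomials grouped by character. -/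
lemma sum_sgn_sq_eq {n : ℕ} (s : Finset (Fin n →₀ ℕ)) (a : (Fin n →₀ ℕ) → ℝ) :
    ∑ ε : Fin n → Bool, (∑ m ∈ s, a m * ∏ i, sgn (ε i) ^ m i) ^ 2 =
      2 ^ n * ∑ S : Finset (Fin n), (∑ m ∈ s with oddSet m = S, a m) ^ 2 := by
  have h1 : ∑ S : Finset (Fin n), (∑ m ∈ s with oddSet m = S, a m) ^ 2 =
      ∑ m ∈ s, ∑ m' ∈ s, if oddSet m = oddSet m' then a m * a m' else 0 := by
    simp only [Finset.sum_filter, sq, Finset.sum_mul_sum]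
    rw [Finset.sum_comm]
    refine Finset.sum_congr rfl fun m _ => ?_
    rw [Finset.sum_comm]
    refine Finset.sum_congr rfl fun m' _ => ?_
    rw [Finset.sum_eq_single (oddSet m)]
    · simp [eq_comm]
    · intro S _ hS
      simp [hS.symm]
    · simp
  rw [h1, Finset.mul_sum]
  simp only [sq, Finset.sum_mul_sum]
  rw [Finset.sum_comm]
  refine Finset.sum_congr rfl fun m _ => ?_
  rw [Finset.sum_comm, Finset.mul_sum]
  refine Finset.sum_congr rfl fun m' _ => ?_
  have := sum_prod_sgn_pow m m'
  calc _ = a m * a m' * ∑ ε : Fin n → Bool,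
        (∏ i, sgn (ε i) ^ m i) * ∏ i, sgn (ε i) ^ m' i := by
        rw [Finset.mul_sum]
        exact Finset.sum_congr rfl fun ε _ => by ring
    _ = _ := by
        rw [this]
        split_ifs <;> ring

lemma oddSet_cases {n : ℕ} {m : Fin n →₀ ℕ} (hm : m.degree = 3) :
    (∃ i j, oddSet m = {i} ∧ ∀ y : Fin n → ℝ, 0 ≤ y →
      ∏ l, √(y l) ^ m l = √(y i) * y j) ∨
    ((oddSet m).card = 3 ∧ ∀ y : Fin n → ℝ, ∏ l, √(y l) ^ m l = ∏ i ∈ oddSet m, √(y i)) := by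
  obtain ⟨i, j, k, h⟩ := Multiset.card_eq_three.1
    (show (Finsupp.toMultiset m).card = 3 by rw [Finsupp.card_toMultiset]; exact hm)
  have hprod : ∀ y : Fin n → ℝ, ∏ l, √(y l) ^ m l = √(y i) * √(y j) * √(y k) := by
    intro y
    rw [prod_pow_eq_toMultiset m (fun l => √(y l)), h]
    simp [mul_assoc]
  have hm' := toMultiset_eq_three h
  have hodd : ∀ l, l ∈ oddSet m ↔
      Odd ((if i = l then 1 else 0) + (if j = l then 1 else 0) + (if k = l then 1 else 0)) := by
    intro l
    simp [oddSet, hm', Finsupp.single_apply]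
  by_cases hij : i = j
  · subst hij
    refine Or.inl ⟨k, i, ?_, fun y hy => ?_⟩
    · ext l
      rw [hodd, Finset.mem_singleton]
      by_cases h1 : i = l <;> by_cases h2 : k = l <;> simp [h1, h2, eq_comm, Nat.odd_iff]
    · rw [hprod, Real.mul_self_sqrt (hy i), mul_comm]
  by_cases hik : i = k
  · subst hik
    refine Or.inl ⟨j, i, ?_, fun y hy => ?_⟩
    · ext l
      rw [hodd, Finset.mem_singleton]
      by_cases h1 : i = l <;> by_cases h2 : j = l <;> simp [h1, h2, eq_comm, Nat.odd_iff]
    · rw [hprod, mul_right_comm, Real.mul_self_sqrt (hy i), mul_comm]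
  by_cases hjk : j = k
  · subst hjk
    refine Or.inl ⟨i, j, ?_, fun y hy => ?_⟩
    · ext l
      rw [hodd, Finset.mem_singleton]
      by_cases h1 : i = l <;> by_cases h2 : j = l <;> simp [h1, h2, eq_comm, Nat.odd_iff]
    · rw [hprod, mul_assoc, Real.mul_self_sqrt (hy j)]
  have hset : oddSet m = {i, j, k} := by
    ext l
    rw [hodd]
    simp only [Finset.mem_insert, Finset.mem_singleton]
    by_cases h1 : i = l
    · subst h1
      simp [Ne.symm hij, Ne.symm hik]
    by_cases h2 : j = l
    · subst h2
      simp [hij, Ne.symm hjk]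
    by_cases h3 : k = l
    · subst h3
      simp [hik, hjk]
    simp [h1, h2, h3, Ne.symm h1, Ne.symm h2, Ne.symm h3]
  refine Or.inr ⟨?_, fun y => ?_⟩
  · rw [hset, Finset.card_eq_three]
    exact ⟨i, j, k, hij, hik, hjk, rfl⟩
  · rw [hprod, hset, Finset.prod_insert (by simp [hij, hik]), Finset.prod_insert (by simp [hjk]),
      Finset.prod_singleton, mul_assoc]

/-- With xᵢ = √yᵢ, a class with odd set {i} sums to xᵢ times a linear form in y, and a class with
odd set {i, j, k} to a multiple of xᵢxⱼxₖ. No other odd set occurs in degree 3. -/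
lemma isCert_parity_class_sq {n : ℕ} {s : Finset (Fin n →₀ ℕ)} (hs : ∀ m ∈ s, m.degree = 3)
    (a : (Fin n →₀ ℕ) → ℝ) (S : Finset (Fin n)) :
    IsCert (fun y => (∑ m ∈ s with oddSet m = S, a m * ∏ i, √(y i) ^ m i) ^ 2) := by
  by_cases h1 : S.card = 1
  · obtain ⟨i, rfl⟩ := Finset.card_eq_one.1 h1
    have hj : ∀ m ∈ s.filter (fun m => oddSet m = {i}), ∃ j, ∀ y : Fin n → ℝ, 0 ≤ y →
        ∏ l, √(y l) ^ m l = √(y i) * y j := by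
      intro m hm
      rw [Finset.mem_filter] at hm
      rcases oddSet_cases (hs m hm.1) with ⟨i', j, hi', H⟩ | ⟨hc, -⟩
      · rw [hm.2, Finset.singleton_inj] at hi'
        exact ⟨j, hi' ▸ H⟩
      · simp [hm.2] at hc
    have : Nonempty (Fin n) := ⟨i⟩
    choose! j hj using hj
    refine (isCert_mul_sq i (∑ m ∈ s with oddSet m = {i}, Pi.single (j m) (a m))).congr
      fun y hy => ?_
    have : ∑ m ∈ s with oddSet m = {i}, a m * ∏ i, √(y i) ^ m i =
        √(y i) * ((∑ m ∈ s with oddSet m = {i}, Pi.single (j m) (a m)) ⬝ᵥ y) := by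
      rw [sum_dotProduct, Finset.mul_sum]
      refine Finset.sum_congr rfl fun m hm => ?_
      rw [hj m hm y hy, single_dotProduct]
      ring
    rw [this, mul_pow, Real.sq_sqrt (hy i)]
  by_cases h3 : S.card = 3
  · obtain ⟨i, j, k, hij, hik, hjk, hS⟩ := Finset.card_eq_three.1 h3
    have hn : ∀ i : Fin n, (0 : Fin n → ℝ) ≤ Pi.single i 1 := fun i => by simp
    refine ((isCert_linear_mul (hn i) (hn j) (hn k)).const_mul
      (sq_nonneg (∑ m ∈ s with oddSet m = S, a m))).congr fun y hy => ?_
    have : ∑ m ∈ s with oddSet m = S, a m * ∏ i, √(y i) ^ m i =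
        (∑ m ∈ s with oddSet m = S, a m) * ∏ i ∈ S, √(y i) := by
      rw [Finset.sum_mul]
      refine Finset.sum_congr rfl fun m hm => ?_
      rw [Finset.mem_filter] at hm
      rcases oddSet_cases (hs m hm.1) with ⟨i', j, hi', -⟩ | ⟨-, H⟩
      · rw [← hm.2, hi'] at h3
        simp at h3
      · rw [H, hm.2]
    rw [this, mul_pow, ← Finset.prod_pow, Finset.prod_congr rfl fun l _ => Real.sq_sqrt (hy l), hS,
      Finset.prod_insert (by simp [hij, hik]), Finset.prod_insert (by simp [hjk]),
      Finset.prod_singleton]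
    simp [single_dotProduct, mul_assoc]
  · have : s.filter (fun m => oddSet m = S) = ∅ := by
      refine Finset.filter_eq_empty_iff.2 fun m hm hS => ?_
      rcases oddSet_cases (hs m hm) with ⟨i, j, hi, -⟩ | ⟨hc, -⟩
      · rw [← hS, hi] at h1
        simp at h1
      · exact h3 (hS ▸ hc)
    refine IsCert.zero.congr fun y _ => ?_
    simp [this]

lemma exists_sum_sq_of_isSumSq {R : Type*} [CommSemiring R] {a : R} (ha : IsSumSq a) :
    ∃ (m : ℕ) (h : Fin m → R), a = ∑ k, h k ^ 2 := by
  induction ha with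
  | zero => exact ⟨0, Fin.elim0, by simp⟩
  | sq_add b _ ih =>
    obtain ⟨m, h, rfl⟩ := ih
    exact ⟨m + 1, Fin.cons b h, by simp [Fin.sum_univ_succ, sq]⟩

/-- A form in the squares of the variables that is a sum of squares of polynomials
comes from a certificate. -/
lemma isCert_of_sum_sq {n m : ℕ} {g : (Fin n → ℝ) → ℝ} (hg : ∀ (t : ℝ) y, g (t • y) = t ^ 3 * g y)
    {h : Fin m → MvPolynomial (Fin n) ℝ}
    (H : ∀ x : Fin n → ℝ, g (fun i => x i ^ 2) = ∑ k, MvPolynomial.eval x (h k) ^ 2) :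
    IsCert g := by
  have hhom : ∀ k, (h k).IsHomogeneous 3 := by
    intro k
    refine isHomogeneous_three_of_sq_eval_le (F := fun x => g (fun i => x i ^ 2)) ?_ ?_
    · intro t x
      have : (fun i => (t • x) i ^ 2) = t ^ 2 • fun i => x i ^ 2 := by
        ext i
        simp [mul_pow]
      simp only [this, hg]
      ring
    · intro x
      simp only [H]
      exact Finset.single_le_sum (f := fun k => MvPolynomial.eval x (h k) ^ 2)
        (fun _ _ => sq_nonneg _) (Finset.mem_univ k)
  have hdeg : ∀ k, ∀ m ∈ (h k).support, m.degree = 3 := by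
    intro k m hm
    rw [Finsupp.degree_eq_weight_one]
    exact hhom k (MvPolynomial.mem_support_iff.1 hm)
  refine (IsCert.sum Finset.univ fun k _ => IsCert.sum Finset.univ fun S _ =>
    isCert_parity_class_sq (hdeg k) (fun m => (h k).coeff m) S).congr fun y hy => ?_
  have h2 : (2 : ℝ) ^ n ≠ 0 := by positivity
  refine mul_left_cancel₀ h2 ?_
  -- The left side sees only squares, so every choice of signs for the roots √yᵢ gives the same
  -- value.
  have hε : ∀ ε : Fin n → Bool, g y = ∑ k, (∑ m ∈ (h k).support,
      ((h k).coeff m * ∏ i, √(y i) ^ m i) * ∏ i, sgn (ε i) ^ m i) ^ 2 := by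
    intro ε
    have := H (fun i => sgn (ε i) * √(y i))
    simp only [mul_pow, sgn_sq, one_mul, fun i => Real.sq_sqrt (hy i)] at this
    rw [this]
    refine Finset.sum_congr rfl fun k _ => ?_
    rw [MvPolynomial.eval_eq']
    congr 1
    refine Finset.sum_congr rfl fun m _ => ?_
    simp only [mul_pow, Finset.prod_mul_distrib]
    ring
  calc 2 ^ n * g y = ∑ ε : Fin n → Bool, g y := by simp
    _ = _ := Finset.sum_congr rfl fun ε _ => hε ε
    _ = _ := by
      rw [Finset.sum_comm, Finset.mul_sum]
      exact Finset.sum_congr rfl fun k _ => sum_sgn_sq_eq _ _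

/-! ### Parrilo's bound in terms of certificates -/

lemma eval_parrilo {n : ℕ} (A : Matrix (Fin n) (Fin n) ℝ) (x : Fin n → ℝ) :
    MvPolynomial.eval x ((∑ i, (MvPolynomial.X i : MvPolynomial (Fin n) ℝ) ^ 2) ^ 1 *
      ∑ i, ∑ j, MvPolynomial.X i ^ 2 * MvPolynomial.C (A i j) * MvPolynomial.X j ^ 2) =
    (∑ i, x i ^ 2) * ((fun i => x i ^ 2) ⬝ᵥ A *ᵥ (fun i => x i ^ 2)) := by
  simp only [map_sum, map_mul, MvPolynomial.eval_C, MvPolynomial.eval_X, dotProduct, map_pow,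
    mulVec, Finset.mul_sum, pow_one]
  congr 1
  ext i
  congr 1
  ext j
  ring_nf

/-- Each Pᵢ is a sum of rank-one vvᵀ, and yᵢ (vᵀy)² becomes the square of xᵢ ∑ vⱼxⱼ² under yᵢ = xᵢ².
-/
lemma isSumSq_of_isCert {n : ℕ} {A : Matrix (Fin n) (Fin n) ℝ}
    (h : IsCert (fun y => (∑ i, y i) * (y ⬝ᵥ A *ᵥ y))) :
    IsSumSq ((∑ i, (MvPolynomial.X i : MvPolynomial (Fin n) ℝ) ^ 2) ^ 1 *
      ∑ i, ∑ j, MvPolynomial.X i ^ 2 * MvPolynomial.C (A i j) * MvPolynomial.X j ^ 2) := by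
  obtain ⟨P, c, hP, hc, H⟩ := h
  have := fun i => posSemidef_iff_eq_sum_vecMulVec.1 (hP i)
  choose m v hv using this
  have key : (∑ i, (MvPolynomial.X i : MvPolynomial (Fin n) ℝ) ^ 2) ^ 1 *
      ∑ i, ∑ j, MvPolynomial.X i ^ 2 * MvPolynomial.C (A i j) * MvPolynomial.X j ^ 2 =
      ∑ i, ∑ l, (MvPolynomial.X i * ∑ j, MvPolynomial.C (v i l j) * MvPolynomial.X j ^ 2) ^ 2 +
      ∑ i, ∑ j, ∑ k, (MvPolynomial.C (√(c i j k)) *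
        (MvPolynomial.X i * MvPolynomial.X j * MvPolynomial.X k)) ^ 2 := by
    refine MvPolynomial.funext fun x => ?_
    rw [eval_parrilo]
    refine (H (fun i => x i ^ 2) (fun i => sq_nonneg _)).trans ?_
    simp only [cubicForm, map_add, map_sum, map_pow, map_mul, MvPolynomial.eval_X,
      MvPolynomial.eval_C, mul_pow, fun i j k => Real.sq_sqrt (hc i j k)]
    congr 1
    refine Finset.sum_congr rfl fun i _ => ?_
    rw [hv i, sum_mulVec, dotProduct_sum, Finset.mul_sum]
    refine Finset.sum_congr rfl fun l _ => ?_
    rw [dotProduct_vecMulVec_mulVec]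
    simp [dotProduct, sq]
  rw [key]
  exact (IsSumSq.sum fun i _ => IsSumSq.sum_sq _ _).add
    (IsSumSq.sum fun i _ => IsSumSq.sum fun j _ => IsSumSq.sum_sq _ _)

lemma mulVec_sub_smul_ones {n : ℕ} (Q : Matrix (Fin n) (Fin n) ℝ) (l : ℝ) (y : Fin n → ℝ) :
    y ⬝ᵥ (Q - l • vecMulVec 1 1) *ᵥ y = y ⬝ᵥ Q *ᵥ y - l * (∑ i, y i) ^ 2 := by
  rw [sub_mulVec, smul_mulVec, dotProduct_sub, dotProduct_smul, dotProduct_vecMulVec_mulVec]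
  simp [sq, dotProduct]

lemma parriloFeasible_one_eq {n : ℕ} {Q : Matrix (Fin n) (Fin n) ℝ} (hQ : Q.IsSymm) :
    parriloFeasible 1 Q = certFeasible Q := by
  ext l
  simp only [parriloFeasible, parriloCone, certFeasible, Set.mem_ofPred_eq]
  simp only [← mulVec_sub_smul_ones]
  constructor
  · rintro ⟨-, h⟩
    obtain ⟨m, p, hp⟩ := exists_sum_sq_of_isSumSq h
    refine isCert_of_sum_sq (h := p) (fun t y => ?_) fun x => ?_
    · simp only [mulVec_smul, smul_dotProduct, dotProduct_smul, Pi.smul_apply, smul_eq_mul,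
        ← Finset.mul_sum]
      ring
    · rw [← eval_parrilo, hp]
      simp
  · intro h
    refine ⟨?_, isSumSq_of_isCert h⟩
    ext i j
    simp [vecMulVec, hQ.apply]

/-! ### From certificates to the cubic bound -/

lemma totalDegree_sum_le {n : ℕ} {ι : Type*} (s : Finset ι) {f : ι → MvPolynomial (Fin n) ℝ}
    {d : ℕ} (hf : ∀ i ∈ s, (f i).totalDegree ≤ d) : (∑ i ∈ s, f i).totalDegree ≤ d :=
  MvPolynomial.totalDegree_finsetSum_le hf

lemma quadForm_mem_quadratics {n : ℕ} (A : Matrix (Fin n) (Fin n) ℝ) :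
    quadForm A ∈ quadratics n := by
  refine totalDegree_sum_le _ fun i _ => totalDegree_sum_le _ fun j _ => ?_
  refine (MvPolynomial.totalDegree_mul _ _).trans ?_
  refine (add_le_add_left (MvPolynomial.totalDegree_mul _ _) _).trans ?_
  simp [MvPolynomial.totalDegree_C, MvPolynomial.totalDegree_X]

lemma totalDegree_sum_X_le {n : ℕ} :
    (∑ i, MvPolynomial.X i : MvPolynomial (Fin n) ℝ).totalDegree ≤ 1 :=
  totalDegree_sum_le _ fun i _ => by simp

lemma convexOn_dotProduct_mulVec {n : ℕ} {A : Matrix (Fin n) (Fin n) ℝ} (hA : A.PosSemidef) :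
    ConvexOn ℝ Set.univ (fun x : Fin n → ℝ => x ⬝ᵥ A *ᵥ x) := by
  refine ⟨convex_univ, fun x _ y _ a b ha hb hab => ?_⟩
  have h := mul_nonneg (mul_nonneg ha hb) (hA.dotProduct_nonneg (x - y))
  obtain rfl : b = 1 - a := by linarith
  simp only [mulVec_add, mulVec_sub, mulVec_smul, add_dotProduct, dotProduct_add, sub_dotProduct,
    dotProduct_sub, smul_dotProduct, dotProduct_smul, smul_eq_mul] at h ⊢
  nlinarith [h]

lemma coeff_mul_nonneg {n : ℕ} {p q : MvPolynomial (Fin n) ℝ} (hp : ∀ m, 0 ≤ p.coeff m)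
    (hq : ∀ m, 0 ≤ q.coeff m) (m : Fin n →₀ ℕ) : 0 ≤ (p * q).coeff m := by
  classical
  rw [MvPolynomial.coeff_mul]
  exact Finset.sum_nonneg fun _ _ => mul_nonneg (hp _) (hq _)

lemma coeff_X_nonneg {n : ℕ} (i : Fin n) (m : Fin n →₀ ℕ) :
    0 ≤ (MvPolynomial.X i : MvPolynomial (Fin n) ℝ).coeff m := by
  classical
  rw [MvPolynomial.coeff_X]
  split_ifs <;> norm_num

lemma coeff_C_nonneg {n : ℕ} {r : ℝ} (hr : 0 ≤ r) (m : Fin n →₀ ℕ) :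
    0 ≤ (MvPolynomial.C r : MvPolynomial (Fin n) ℝ).coeff m := by
  classical
  rw [MvPolynomial.coeff_C]
  split_ifs <;> simp [hr]

lemma certFeasible_subset_cubicFeasible {n : ℕ} (Q : Matrix (Fin n) (Fin n) ℝ) :
    certFeasible Q ⊆ cubicFeasible Q := by
  rintro l ⟨P, c, hP, hc, H⟩
  let κ : MvPolynomial (Fin n) ℝ := ∑ i, ∑ j, ∑ k, MvPolynomial.C (c i j k) *
    (MvPolynomial.X i * MvPolynomial.X j * MvPolynomial.X k)
  let s : MvPolynomial (Fin n) ℝ := ∑ i, MvPolynomial.X i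
  have hpoly : s * (quadForm Q - MvPolynomial.C l * s ^ 2) =
      ∑ i, quadForm (P i) * MvPolynomial.X i + κ := by
    -- Agreement on the orthant, a product of infinite sets, already forces equality of polynomials.
    refine MvPolynomial.funext_set (fun _ => Set.Ici 0) (fun _ => Set.Ici_infinite 0) fun y hy => ?_
    have hy0 : 0 ≤ y := fun i => hy i (Set.mem_univ i)
    simp only [s, κ, map_mul, map_sub, map_add, map_sum, map_pow, eval_quadForm,
      MvPolynomial.eval_X, MvPolynomial.eval_C]
    refine (H y hy0).trans ?_
    rw [cubicForm]
    congr 1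
    exact Finset.sum_congr rfl fun i _ => mul_comm _ _
  have hs : s.totalDegree ≤ 1 := totalDegree_sum_X_le
  -- This β comes from s³ - 1 = (s - 1)(s² + s + 1): it turns xᵀQx - l into s (xᵀQx - l s²), so the
  -- remainder is exactly 0.
  refine ⟨fun i => quadForm (P i), quadForm Q - MvPolynomial.C l * (s ^ 2 + s + 1), κ,
    fun i => ⟨⟨quadForm_mem_quadratics _, fun x _ => ?_⟩, ?_⟩, ?_, ⟨?_, fun m => ?_⟩, ?_⟩
  · rw [eval_quadForm]
    exact (hP i).dotProduct_nonneg x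
  · simp only [eval_quadForm]
    exact convexOn_dotProduct_mulVec (hP i)
  · refine (MvPolynomial.totalDegree_sub _ _).trans (max_le (quadForm_mem_quadratics _) ?_)
    refine (MvPolynomial.totalDegree_mul _ _).trans ?_
    rw [MvPolynomial.totalDegree_C, zero_add]
    refine (MvPolynomial.totalDegree_add _ _).trans (max_le ?_ (by simp))
    refine (MvPolynomial.totalDegree_add _ _).trans (max_le ?_ (by omega))
    exact (MvPolynomial.totalDegree_pow _ _).trans (by omega)
  · refine totalDegree_sum_le _ fun i _ => totalDegree_sum_le _ fun j _ =>
      totalDegree_sum_le _ fun k _ => ?_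
    have h1 := MvPolynomial.totalDegree_mul (MvPolynomial.C (c i j k))
      (MvPolynomial.X i * MvPolynomial.X j * MvPolynomial.X k : MvPolynomial (Fin n) ℝ)
    have h2 := MvPolynomial.totalDegree_mul (MvPolynomial.X i * MvPolynomial.X j)
      (MvPolynomial.X k : MvPolynomial (Fin n) ℝ)
    have h3 := MvPolynomial.totalDegree_mul (MvPolynomial.X i)
      (MvPolynomial.X j : MvPolynomial (Fin n) ℝ)
    simp only [MvPolynomial.totalDegree_C, MvPolynomial.totalDegree_X] at h1 h2 h3
    omega
  · simp only [κ, MvPolynomial.coeff_sum]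
    exact Finset.sum_nonneg fun i _ => Finset.sum_nonneg fun j _ => Finset.sum_nonneg fun k _ =>
      coeff_mul_nonneg (coeff_C_nonneg (hc i j k)) (coeff_mul_nonneg (coeff_mul_nonneg
        (coeff_X_nonneg i) (coeff_X_nonneg j)) (coeff_X_nonneg k)) m
  · have h0 : quadForm Q - MvPolynomial.C l - ∑ i, quadForm (P i) * MvPolynomial.X i
        + (quadForm Q - MvPolynomial.C l * (s ^ 2 + s + 1)) * (∑ i, MvPolynomial.X i - 1) - κ
        = 0 := by
      change _ + _ * (s - 1) - κ = 0
      linear_combination hpoly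
    rw [h0]
    exact ⟨by simp [quadratics], fun x _ => by simp⟩

/-! ### From the cubic bound to certificates -/

lemma exists_eval_eq_quadratic {n : ℕ} {q : MvPolynomial (Fin n) ℝ} (hq : q ∈ quadratics n) :
    ∃ (B : Matrix (Fin n) (Fin n) ℝ) (b : Fin n → ℝ) (c : ℝ), B.IsSymm ∧
      ∀ x, MvPolynomial.eval x q = x ⬝ᵥ B *ᵥ x + b ⬝ᵥ x + c := by
  classical
  have key : ∀ s : Finset (Fin n →₀ ℕ), (∀ m ∈ s, m.degree ≤ 2) →
      ∃ (B : Matrix (Fin n) (Fin n) ℝ) (b : Fin n → ℝ) (c : ℝ), B.IsSymm ∧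
      ∀ x : Fin n → ℝ, ∑ m ∈ s, q.coeff m * ∏ i, x i ^ m i = x ⬝ᵥ B *ᵥ x + b ⬝ᵥ x + c := by
    intro s
    induction s using Finset.induction_on with
    | empty => exact fun _ => ⟨0, 0, 0, isSymm_zero, by simp⟩
    | insert m s hm ih =>
      intro hs
      obtain ⟨B, b, c, hB, H⟩ := ih fun m' hm' => hs m' (Finset.mem_insert_of_mem hm')
      have hmd : (Finsupp.toMultiset m).card ≤ 2 := by
        rw [Finsupp.card_toMultiset]
        exact hs m (Finset.mem_insert_self _ _)
      simp only [Finset.sum_insert hm, H, prod_pow_eq_toMultiset m]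
      set t := Finsupp.toMultiset m
      obtain h | h | h : t.card = 0 ∨ t.card = 1 ∨ t.card = 2 := by omega
      · rw [Multiset.card_eq_zero] at h
        refine ⟨B, b, c + q.coeff m, hB, fun x => ?_⟩
        simp [h]
        ring
      · obtain ⟨i, h⟩ := Multiset.card_eq_one.1 h
        refine ⟨B, b + Pi.single i (q.coeff m), c, hB, fun x => ?_⟩
        simp [h, add_dotProduct, single_dotProduct]
        ring
      · obtain ⟨i, j, h⟩ := Multiset.card_eq_two.1 h
        refine ⟨B + (q.coeff m / 2) • (vecMulVec (Pi.single i 1) (Pi.single j 1) +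
          vecMulVec (Pi.single j 1) (Pi.single i 1)), b, c, hB.add (IsSymm.smul ?_ _), fun x => ?_⟩
        · rw [IsSymm, transpose_add, transpose_vecMulVec, transpose_vecMulVec, add_comm]
        · simp [h, add_mulVec, smul_mulVec, dotProduct_add, dotProduct_vecMulVec_mulVec,
            single_dotProduct]
          ring
  obtain ⟨B, b, c, hB, H⟩ := key q.support fun m hm => (MvPolynomial.le_totalDegree hm).trans hq
  exact ⟨B, b, c, hB, fun x => by rw [MvPolynomial.eval_eq', H]⟩

lemma nonneg_of_forall_add_mul_nonneg {a w : ℝ} (h : ∀ t, 0 < t → t ≤ 1 → 0 ≤ a + t * w) :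
    0 ≤ a := by
  by_contra! ha
  have hp : 0 < |w| - a := by linarith [abs_nonneg w]
  have h1 := h (-a / (|w| - a)) (div_pos (by linarith) hp)
    ((div_le_one hp).2 (by linarith [abs_nonneg w]))
  have h2 : -a / (|w| - a) * w ≤ -a / (|w| - a) * |w| :=
    mul_le_mul_of_nonneg_left (le_abs_self w) (div_pos (by linarith) hp).le
  have h3 : -a / (|w| - a) * |w| < -a := by
    rw [div_mul_eq_mul_div, div_lt_iff₀ hp]
    nlinarith
  linarith

/-- A convex quadratic that is nonnegative on the standard simplex is, on the simplex,
the sum of a nonnegative affine function and a convex quadratic form centred at a minimiser. -/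
lemma exists_simplex_decomposition {n : ℕ} (hn : 0 < n) {B : Matrix (Fin n) (Fin n) ℝ}
    (hB : B.IsSymm) (b : Fin n → ℝ) (c : ℝ)
    (hq : ∀ x ∈ stdSimplex ℝ (Fin n), 0 ≤ x ⬝ᵥ B *ᵥ x + b ⬝ᵥ x + c) :
    ∃ (z g : Fin n → ℝ) (r : ℝ), 0 ≤ g ∧ 0 ≤ r ∧ ∀ x : Fin n → ℝ, ∑ i, x i = 1 →
      x ⬝ᵥ B *ᵥ x + b ⬝ᵥ x + c = r + g ⬝ᵥ x + (x - z) ⬝ᵥ B *ᵥ (x - z) := by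
  have hcont : Continuous fun x : Fin n → ℝ => x ⬝ᵥ B *ᵥ x + b ⬝ᵥ x + c := by
    simp only [dotProduct, mulVec]
    fun_prop
  obtain ⟨z, hz, hmin⟩ := (isCompact_stdSimplex ℝ (Fin n)).exists_isMinOn
    ⟨_, single_mem_stdSimplex ℝ (⟨0, hn⟩ : Fin n)⟩ hcont.continuousOn
  have hsymm : ∀ u v : Fin n → ℝ, u ⬝ᵥ B *ᵥ v = v ⬝ᵥ B *ᵥ u := fun u v => by
    rw [dotProduct_mulVec, ← mulVec_transpose, hB.eq, dotProduct_comm]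
  -- The gradient of the quadratic at the minimiser z.
  set d : Fin n → ℝ := (2 : ℝ) • (B *ᵥ z) + b with hd
  have hexp : ∀ v, (z + v) ⬝ᵥ B *ᵥ (z + v) + b ⬝ᵥ (z + v) + c =
      (z ⬝ᵥ B *ᵥ z + b ⬝ᵥ z + c) + d ⬝ᵥ v + v ⬝ᵥ B *ᵥ v := by
    intro v
    simp only [hd, mulVec_add, add_dotProduct, dotProduct_add, smul_dotProduct, smul_eq_mul,
      hsymm z v, dotProduct_comm (B *ᵥ z) v]
    ring
  refine ⟨z, fun j => d j - d ⬝ᵥ z, z ⬝ᵥ B *ᵥ z + b ⬝ᵥ z + c, fun j => ?_, hq z hz,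
    fun x hx => ?_⟩
  -- First-order optimality at z in the direction of the vertex eⱼ.
  · set v : Fin n → ℝ := Pi.single j 1 - z with hv
    have hdv : d ⬝ᵥ v = d j - d ⬝ᵥ z := by simp [hv, dotProduct_sub]
    change 0 ≤ d j - d ⬝ᵥ z
    rw [← hdv]
    refine nonneg_of_forall_add_mul_nonneg (w := v ⬝ᵥ B *ᵥ v) fun t ht0 ht1 => ?_
    have hmem : z + t • v ∈ stdSimplex ℝ (Fin n) :=
      (convex_stdSimplex ℝ (Fin n)).add_smul_sub_mem hz (single_mem_stdSimplex ℝ j) ⟨ht0.le, ht1⟩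
    have h1 := hmin hmem
    simp only [Set.mem_ofPred_eq, hexp, mulVec_smul, smul_dotProduct, dotProduct_smul,
      smul_eq_mul] at h1
    have h2 : 0 ≤ t * (d ⬝ᵥ v + t * (v ⬝ᵥ B *ᵥ v)) := by linarith
    exact nonneg_of_mul_nonneg_right h2 ht0
  · have h1 := hexp (x - z)
    rw [add_sub_cancel] at h1
    have h2 : (fun j => d j - d ⬝ᵥ z) ⬝ᵥ x = d ⬝ᵥ (x - z) := by
      rw [dotProduct_sub]
      simp only [dotProduct, sub_mul, Finset.sum_sub_distrib, ← Finset.mul_sum, hx, mul_one]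
    rw [h1, h2]

lemma eq_zero_of_sum_eq_zero {n : ℕ} {y : Fin n → ℝ} (hy : 0 ≤ y) (h : ∑ i, y i = 0) : y = 0 :=
  funext fun i => (Finset.sum_eq_zero_iff_of_nonneg fun i _ => hy i).1 h i (Finset.mem_univ i)

/-- The simplex decomposition is homogenized termwise: r, gᵀx and the centred form become r s², s
gᵀy and (y - s z)ᵀB(y - s z). -/
lemma isCert_mul_quadratic {n : ℕ} (hn : 0 < n) {B : Matrix (Fin n) (Fin n) ℝ}
    (hB : B.PosSemidef) (b : Fin n → ℝ) (c : ℝ)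
    (hq : ∀ x ∈ stdSimplex ℝ (Fin n), 0 ≤ x ⬝ᵥ B *ᵥ x + b ⬝ᵥ x + c)
    {q : (Fin n → ℝ) → ℝ} (hqe : ∀ x, q x = x ⬝ᵥ B *ᵥ x + b ⬝ᵥ x + c) (i : Fin n) :
    IsCert (fun y => y i * ((∑ j, y j) ^ 2 * q ((∑ j, y j)⁻¹ • y))) := by
  obtain ⟨z, g, r, hg, hr, H⟩ :=
    exists_simplex_decomposition hn (posSemidef_iff_real.1 hB).1 b c hq
  have hi : (0 : Fin n → ℝ) ≤ Pi.single i 1 := by simp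
  have h1 : (0 : Fin n → ℝ) ≤ 1 := zero_le_one
  -- M sends y to y - s z, so MᵀBM is the homogenized centred form.
  let M : Matrix (Fin n) (Fin n) ℝ := 1 - vecMulVec z 1
  refine (((((isCert_linear_mul hi h1 h1).const_mul hr).add (isCert_linear_mul hi h1 hg)).add
    (isCert_mul_of_posSemidef (hB.conjTranspose_mul_mul_same M) i))).congr fun y hy => ?_
  have hM : y ⬝ᵥ (Mᴴ * B * M) *ᵥ y = (y - (∑ j, y j) • z) ⬝ᵥ B *ᵥ (y - (∑ j, y j) • z) := by
    have hMy : M *ᵥ y = y - (∑ j, y j) • z := by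
      rw [sub_mulVec, one_mulVec, vecMulVec_mulVec, op_smul_eq_smul, one_dotProduct]
    rw [← mulVec_mulVec, ← mulVec_mulVec, dotProduct_mulVec, conjTranspose_eq_transpose_of_trivial,
      vecMul_transpose, hMy]
  rw [hM]
  simp only [single_dotProduct, one_dotProduct, one_mul]
  set s := ∑ j, y j with hs
  rcases eq_or_ne s 0 with h0 | h0
  · simp [eq_zero_of_sum_eq_zero hy h0]
  have hsum : ∑ j, (s⁻¹ • y) j = 1 := by
    simp [← Finset.mul_sum, ← hs, h0]
  have hz : s⁻¹ • y - z = s⁻¹ • (y - s • z) := by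
    rw [smul_sub, smul_smul, inv_mul_cancel₀ h0, one_smul]
  rw [hqe, H _ hsum, hz]
  simp only [mulVec_smul, smul_dotProduct, dotProduct_smul, smul_eq_mul]
  field_simp

/-- A monomial of degree at most three is padded with factors s up to degree three. -/
lemma isCert_nonnegCoeffCubic {n : ℕ} {κ : MvPolynomial (Fin n) ℝ} (hκ : κ ∈ nonnegCoeffCubics n) :
    IsCert (fun y => (∑ j, y j) ^ 3 * MvPolynomial.eval ((∑ j, y j)⁻¹ • y) κ) := by
  have h1 : (0 : Fin n → ℝ) ≤ 1 := zero_le_one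
  have hi : ∀ i : Fin n, (0 : Fin n → ℝ) ≤ Pi.single i 1 := fun i => by simp
  have key : ∀ m ∈ κ.support, IsCert (fun y : Fin n → ℝ =>
      κ.coeff m * ((∑ j, y j) ^ 3 * ∏ i, ((∑ j, y j)⁻¹ • y) i ^ m i)) := by
    intro m hm
    refine IsCert.const_mul ?_ (hκ.2 m)
    have hmd : (Finsupp.toMultiset m).card ≤ 3 := by
      rw [Finsupp.card_toMultiset]
      exact (MvPolynomial.le_totalDegree hm).trans hκ.1
    have : ∃ a b d : Fin n → ℝ, 0 ≤ a ∧ 0 ≤ b ∧ 0 ≤ d ∧ ∀ y : Fin n → ℝ, ∑ j, y j ≠ 0 →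
        (∑ j, y j) ^ 3 * ∏ i, ((∑ j, y j)⁻¹ • y) i ^ m i =
          (a ⬝ᵥ y) * (b ⬝ᵥ y) * (d ⬝ᵥ y) := by
      simp only [prod_pow_eq_toMultiset m]
      set t := Finsupp.toMultiset m
      obtain h | h | h | h : t.card = 0 ∨ t.card = 1 ∨ t.card = 2 ∨ t.card = 3 := by omega
      · rw [Multiset.card_eq_zero] at h
        refine ⟨1, 1, 1, h1, h1, h1, fun y hy => ?_⟩
        simp [h, one_dotProduct]
        ring
      · obtain ⟨i, h⟩ := Multiset.card_eq_one.1 h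
        refine ⟨Pi.single i 1, 1, 1, hi i, h1, h1, fun y hy => ?_⟩
        simp [h, one_dotProduct, single_dotProduct]
        field_simp
      · obtain ⟨i, j, h⟩ := Multiset.card_eq_two.1 h
        refine ⟨Pi.single i 1, Pi.single j 1, 1, hi i, hi j, h1, fun y hy => ?_⟩
        simp [h, one_dotProduct, single_dotProduct]
        field_simp
      · obtain ⟨i, j, k, h⟩ := Multiset.card_eq_three.1 h
        refine ⟨Pi.single i 1, Pi.single j 1, Pi.single k 1, hi i, hi j, hi k, fun y hy => ?_⟩
        simp [h, single_dotProduct]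
        field_simp
    obtain ⟨a, b, d, ha, hb, hd, H⟩ := this
    refine (isCert_linear_mul ha hb hd).congr fun y hy => ?_
    rcases eq_or_ne (∑ j, y j) 0 with h0 | h0
    · simp [eq_zero_of_sum_eq_zero hy h0]
    · exact H y h0
  refine (IsCert.sum κ.support key).congr fun y _ => ?_
  rw [MvPolynomial.eval_eq', Finset.mul_sum]
  exact Finset.sum_congr rfl fun m _ => by ring

lemma posSemidef_of_convexOn {n : ℕ} {B : Matrix (Fin n) (Fin n) ℝ} (hB : B.IsSymm)
    {b : Fin n → ℝ} {c : ℝ} {q : (Fin n → ℝ) → ℝ} (hq : ConvexOn ℝ Set.univ q)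
    (hqe : ∀ x, q x = x ⬝ᵥ B *ᵥ x + b ⬝ᵥ x + c) : B.PosSemidef := by
  refine posSemidef_iff_real.2 ⟨hB, fun v => ?_⟩
  have h := hq.2 (Set.mem_univ v) (Set.mem_univ (-v)) (half_pos one_pos).le
    (half_pos one_pos).le (add_halves 1)
  rw [smul_neg, add_neg_cancel] at h
  simp [hqe, mulVec_neg] at h
  linarith

/-- Adding the values at ±v/t cancels the linear term, and scaling by t² makes the constant
negligible as t → 0. -/
lemma posSemidef_of_nonneg {n : ℕ} {B : Matrix (Fin n) (Fin n) ℝ} (hB : B.IsSymm)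
    {b : Fin n → ℝ} {c : ℝ} (hq : ∀ x, 0 ≤ x ⬝ᵥ B *ᵥ x + b ⬝ᵥ x + c) : B.PosSemidef := by
  refine posSemidef_iff_real.2 ⟨hB, fun v => ?_⟩
  refine nonneg_of_forall_add_mul_nonneg (w := c) fun t ht ht1 => ?_
  have h1 := hq (t⁻¹ • v)
  have h2 := hq (-(t⁻¹ • v))
  simp only [mulVec_neg, neg_dotProduct, dotProduct_neg, mulVec_smul, smul_dotProduct,
    dotProduct_smul, smul_eq_mul] at h1 h2
  have hc : 0 ≤ c := by simpa using hq 0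
  have h3 : 0 ≤ t ^ 2 * (t⁻¹ * (t⁻¹ * (v ⬝ᵥ B *ᵥ v)) + c) := mul_nonneg (sq_nonneg t) (by linarith)
  have h4 : t ^ 2 * (t⁻¹ * (t⁻¹ * (v ⬝ᵥ B *ᵥ v)) + c) = v ⬝ᵥ B *ᵥ v + t ^ 2 * c := by
    field_simp
  nlinarith [mul_nonneg (mul_nonneg ht.le (sub_nonneg.2 ht1)) hc]

lemma cubicFeasible_subset_certFeasible {n : ℕ} (hn : 0 < n) (Q : Matrix (Fin n) (Fin n) ℝ) :
    cubicFeasible Q ⊆ certFeasible Q := by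
  rintro l ⟨α, β, κ, hα, -, hκ, hσ⟩
  have hαc : ∀ i, IsCert (fun y => y i * ((∑ j, y j) ^ 2 *
      MvPolynomial.eval ((∑ j, y j)⁻¹ • y) (α i))) := by
    intro i
    obtain ⟨B, b, c, hB, H⟩ := exists_eval_eq_quadratic (hα i).1.1
    exact isCert_mul_quadratic hn (posSemidef_of_convexOn hB (hα i).2 H) b c
      (fun x hx => H x ▸ (hα i).1.2 x hx) H i
  set σ := quadForm Q - MvPolynomial.C l - ∑ i, α i * MvPolynomial.X i
      + β * (∑ i, MvPolynomial.X i - 1) - κ with hσdef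
  have hσc : ∀ i, IsCert (fun y => y i * ((∑ j, y j) ^ 2 *
      MvPolynomial.eval ((∑ j, y j)⁻¹ • y) σ)) := by
    intro i
    obtain ⟨B, b, c, hB, H⟩ := exists_eval_eq_quadratic hσ.1
    have hpos : ∀ x, 0 ≤ x ⬝ᵥ B *ᵥ x + b ⬝ᵥ x + c := fun x => H x ▸ hσ.2 x (Set.mem_univ x)
    exact isCert_mul_quadratic hn (posSemidef_of_nonneg hB hpos) b c (fun x _ => hpos x) H i
  -- The remainder σ has no factor xᵢ of its own; summing yᵢ times its homogenization over i
  -- supplies the missing factor s.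
  refine (((IsCert.sum Finset.univ fun i _ => hαc i).add (isCert_nonnegCoeffCubic hκ)).add
    (IsCert.sum Finset.univ fun i _ => hσc i)).congr fun y hy => ?_
  simp only [← Finset.sum_mul]
  set s := ∑ j, y j with hs
  rcases eq_or_ne s 0 with h0 | h0
  · simp [h0]
  have h1 : MvPolynomial.eval (s⁻¹ • y) σ = (s⁻¹ • y) ⬝ᵥ Q *ᵥ (s⁻¹ • y) - l -
      s⁻¹ * ∑ i, y i * MvPolynomial.eval (s⁻¹ • y) (α i) - MvPolynomial.eval (s⁻¹ • y) κ := by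
    have hsum : ∑ j, s⁻¹ * y j = 1 := by
      rw [← Finset.mul_sum, ← hs, inv_mul_cancel₀ h0]
    simp only [hσdef, map_sub, map_add, map_mul, map_sum, eval_quadForm, MvPolynomial.eval_C,
      MvPolynomial.eval_X, map_one, Pi.smul_apply, smul_eq_mul, hsum, Finset.mul_sum]
    rw [sub_self, mul_zero, add_zero]
    congr 2
    exact Finset.sum_congr rfl fun i _ => by ring
  have h2 : ∑ i, y i * (s ^ 2 * MvPolynomial.eval (s⁻¹ • y) (α i)) =
      s ^ 2 * ∑ i, y i * MvPolynomial.eval (s⁻¹ • y) (α i) := by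
    rw [Finset.mul_sum]
    exact Finset.sum_congr rfl fun i _ => by ring
  rw [h2, h1]
  simp only [mulVec_smul, smul_dotProduct, dotProduct_smul, smul_eq_mul]
  field_simp
  ring

lemma cubicFeasible_eq {n : ℕ} (hn : 0 < n) (Q : Matrix (Fin n) (Fin n) ℝ) :
    cubicFeasible Q = certFeasible Q :=
  (cubicFeasible_subset_certFeasible hn Q).antisymm (certFeasible_subset_cubicFeasible Q)

/-! ### Compactness of certificates and attainment -/

lemma le_cubicForm {n : ℕ} {P : Fin n → Matrix (Fin n) (Fin n) ℝ} {c : Fin n → Fin n → Fin n → ℝ}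
    (hP : ∀ i, (P i).PosSemidef) (hc : ∀ i j k, 0 ≤ c i j k) {y : Fin n → ℝ} (hy : 0 ≤ y)
    (i : Fin n) : y i * (y ⬝ᵥ P i *ᵥ y) ≤ cubicForm P c y := by
  have h1 := Finset.single_le_sum (f := fun i => y i * (y ⬝ᵥ P i *ᵥ y))
    (fun i _ => mul_nonneg (hy i) ((hP i).dotProduct_nonneg y)) (Finset.mem_univ i)
  have h2 : 0 ≤ ∑ i, ∑ j, ∑ k, c i j k * (y i * y j * y k) :=
    Finset.sum_nonneg fun i _ => Finset.sum_nonneg fun j _ => Finset.sum_nonneg fun k _ =>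
      mul_nonneg (hc i j k) (mul_nonneg (mul_nonneg (hy i) (hy j)) (hy k))
  exact h1.trans (le_add_of_nonneg_right h2)

lemma coeff_le_cubicForm_one {n : ℕ} {P : Fin n → Matrix (Fin n) (Fin n) ℝ}
    {c : Fin n → Fin n → Fin n → ℝ} (hP : ∀ i, (P i).PosSemidef) (hc : ∀ i j k, 0 ≤ c i j k)
    (i j k : Fin n) : c i j k ≤ cubicForm P c 1 := by
  have h1 : 0 ≤ ∑ i, (1 : Fin n → ℝ) i * (1 ⬝ᵥ P i *ᵥ 1) :=
    Finset.sum_nonneg fun i _ => mul_nonneg zero_le_one ((hP i).dotProduct_nonneg 1)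
  have h2 : c i j k ≤ ∑ k, c i j k :=
    Finset.single_le_sum (fun k _ => hc i j k) (Finset.mem_univ k)
  have h3 : ∑ k, c i j k ≤ ∑ j, ∑ k, c i j k :=
    Finset.single_le_sum (f := fun j => ∑ k, c i j k)
      (fun j _ => Finset.sum_nonneg fun k _ => hc i j k) (Finset.mem_univ j)
  have h4 : ∑ j, ∑ k, c i j k ≤ ∑ i, ∑ j, ∑ k, c i j k :=
    Finset.single_le_sum (f := fun i => ∑ j, ∑ k, c i j k)
      (fun i _ => Finset.sum_nonneg fun j _ => Finset.sum_nonneg fun k _ => hc i j k)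
      (Finset.mem_univ i)
  simp only [cubicForm, Pi.one_apply, mul_one] at h1 ⊢
  linarith

lemma _root_.Matrix.PosSemidef.abs_apply_le {n : ℕ} {A : Matrix (Fin n) (Fin n) ℝ}
    (hA : A.PosSemidef) {R : ℝ} (hR : ∀ j, A j j ≤ R) (j k : Fin n) : |A j k| ≤ R := by
  have hs : A k j = A j k := (posSemidef_iff_real.1 hA).1.apply j k
  have h1 := hA.dotProduct_nonneg (Pi.single j 1 + Pi.single k 1)
  have h2 := hA.dotProduct_nonneg (Pi.single j 1 - Pi.single k 1)
  simp [mulVec_add, mulVec_sub, dotProduct_add, dotProduct_sub, hs] at h1 h2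
  have hj := hR j
  have hk := hR k
  rw [abs_le]
  constructor <;> linarith

/-- Parallelogram law for v + eⱼ and v. With v = 1 it bounds diagonal entries by values at points y
≥ 1, where a factor yᵢ only increases the form. -/
lemma _root_.Matrix.PosSemidef.diag_le {n : ℕ} {A : Matrix (Fin n) (Fin n) ℝ}
    (hA : A.PosSemidef) (j : Fin n) (v : Fin n → ℝ) :
    A j j ≤ 2 * ((v + Pi.single j 1) ⬝ᵥ A *ᵥ (v + Pi.single j 1) + v ⬝ᵥ A *ᵥ v) := by
  have h := hA.dotProduct_nonneg (v + v + Pi.single j 1)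
  simp [mulVec_add, dotProduct_add] at h ⊢
  linarith

lemma certFeasible_nonempty {n : ℕ} (Q : Matrix (Fin n) (Fin n) ℝ) : (certFeasible Q).Nonempty := by
  obtain ⟨l, hl⟩ := (Set.finite_range fun p : Fin n × Fin n => Q p.1 p.2).bddBelow
  -- With l below every entry of Q, the coefficients Qⱼₖ - l are nonnegative and no Pᵢ is needed.
  refine ⟨l, 0, fun _ j k => Q j k - l, fun _ => PosSemidef.zero,
    fun i j k => sub_nonneg.2 (hl ⟨(j, k), rfl⟩), fun y _ => ?_⟩
  have h : y ⬝ᵥ Q *ᵥ y - l * (∑ i, y i) ^ 2 = ∑ j, ∑ k, (Q j k - l) * (y j * y k) := by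
    rw [sq, Finset.sum_mul_sum]
    simp only [dotProduct, mulVec, Finset.mul_sum, ← Finset.sum_sub_distrib]
    exact Finset.sum_congr rfl fun j _ => Finset.sum_congr rfl fun k _ => by ring
  simp only [h, cubicForm, Finset.sum_mul]
  simp only [Pi.zero_apply, zero_mulVec, dotProduct_zero, mul_zero, Finset.sum_const_zero, zero_add,
    Finset.mul_sum]
  exact Finset.sum_congr rfl fun i _ => Finset.sum_congr rfl fun j _ =>
    Finset.sum_congr rfl fun k _ => by ring

/-- At the vertex eᵢ the certified form equals Qᵢᵢ - l and is nonnegative. -/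
lemma le_diag_of_mem_certFeasible {n : ℕ} {Q : Matrix (Fin n) (Fin n) ℝ} {l : ℝ}
    (hl : l ∈ certFeasible Q) (i : Fin n) : l ≤ Q i i := by
  obtain ⟨P, c, hP, hc, H⟩ := hl
  have hi : (0 : Fin n → ℝ) ≤ Pi.single i 1 := by simp
  have h1 := H _ hi
  have h2 := le_cubicForm hP hc hi i
  have h3 := mul_nonneg (hi i) ((hP i).dotProduct_nonneg (Pi.single i 1))
  rw [← h1] at h2
  simp at h2 h3
  linarith

/-- Parameters `(l, P, c)` of certificates with `l₀ ≤ l`. -/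
def certParams {n : ℕ} (Q : Matrix (Fin n) (Fin n) ℝ) (l₀ : ℝ) :
    Set (ℝ × (Fin n → Fin n → Fin n → ℝ) × (Fin n → Fin n → Fin n → ℝ)) :=
  {x | l₀ ≤ x.1 ∧ (∀ i, (Matrix.of (x.2.1 i)).PosSemidef) ∧ (∀ i j k, 0 ≤ x.2.2 i j k) ∧
    ∀ y, 0 ≤ y → (∑ i, y i) * (y ⬝ᵥ Q *ᵥ y - x.1 * (∑ i, y i) ^ 2) =
      cubicForm (fun i => Matrix.of (x.2.1 i)) x.2.2 y}

lemma isClosed_certParams {n : ℕ} (Q : Matrix (Fin n) (Fin n) ℝ) (l₀ : ℝ) :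
    IsClosed (certParams Q l₀) := by
  simp only [certParams, posSemidef_iff_real, IsSymm.ext_iff, of_apply, cubicForm, dotProduct,
    mulVec, Set.ofPred_and, Set.ofPred_forall]
  refine (isClosed_le (by fun_prop) (by fun_prop)).inter (IsClosed.inter ?_ (IsClosed.inter ?_ ?_))
  · refine isClosed_iInter fun i => IsClosed.inter ?_ ?_
    · exact isClosed_iInter fun j => isClosed_iInter fun k =>
        isClosed_eq (by fun_prop) (by fun_prop)
    · exact isClosed_iInter fun v => isClosed_le (by fun_prop) (by fun_prop)
  · exact isClosed_iInter fun i => isClosed_iInter fun j => isClosed_iInter fun k =>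
      isClosed_le (by fun_prop) (by fun_prop)
  · exact isClosed_iInter fun y => isClosed_iInter fun _ => isClosed_eq (by fun_prop) (by fun_prop)

lemma isCompact_certParams {n : ℕ} (hn : 0 < n) (Q : Matrix (Fin n) (Fin n) ℝ) (l₀ : ℝ) :
    IsCompact (certParams Q l₀) := by
  -- Since l ≥ l₀, G dominates every certified form on the orthant, giving bounds independent of the
  -- certificate.
  let G : (Fin n → ℝ) → ℝ := fun y => (∑ i, y i) * (y ⬝ᵥ Q *ᵥ y - l₀ * (∑ i, y i) ^ 2)
  obtain ⟨R, hR⟩ := (Set.finite_range fun j : Fin n =>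
    2 * (G (1 + Pi.single j 1) + G 1)).bddAbove
  let i₀ : Fin n := ⟨0, hn⟩
  refine IsCompact.of_isClosed_subset (isCompact_Icc (a := (l₀, (fun _ _ _ => -R), fun _ _ _ => 0))
    (b := (Q i₀ i₀, (fun _ _ _ => R), fun _ _ _ => G 1))) (isClosed_certParams Q l₀) ?_
  rintro ⟨l, P, c⟩ ⟨hl, hP, hc, H⟩
  have hlQ : l ≤ Q i₀ i₀ := le_diag_of_mem_certFeasible ⟨_, _, hP, hc, H⟩ i₀
  have hG : ∀ y, 0 ≤ y → cubicForm (fun i => Matrix.of (P i)) c y ≤ G y := by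
    intro y hy
    rw [← H y hy]
    exact mul_le_mul_of_nonneg_left (sub_le_sub_left (mul_le_mul_of_nonneg_right hl (sq_nonneg _)) _)
      (Finset.sum_nonneg fun i _ => hy i)
  have hquad : ∀ i y, 1 ≤ y → y ⬝ᵥ Matrix.of (P i) *ᵥ y ≤ G y := by
    intro i y hy
    have hy0 : 0 ≤ y := zero_le_one.trans hy
    refine le_trans ?_ ((le_cubicForm hP hc hy0 i).trans (hG y hy0))
    exact le_mul_of_one_le_left ((hP i).dotProduct_nonneg y) (hy i)
  have hPb : ∀ i j k, |P i j k| ≤ R := by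
    intro i
    refine (hP i).abs_apply_le fun j => ((hP i).diag_le j 1).trans (le_trans ?_ (hR ⟨j, rfl⟩))
    have h1 := hquad i 1 le_rfl
    have h2 := hquad i (1 + Pi.single j 1) (le_add_of_nonneg_right (by simp))
    linarith
  have hcb : ∀ i j k, c i j k ≤ G 1 := fun i j k =>
    (coeff_le_cubicForm_one hP hc i j k).trans (hG 1 zero_le_one)
  exact ⟨⟨hl, fun i j k => (abs_le.1 (hPb i j k)).1, hc⟩,
    ⟨hlQ, fun i j k => (abs_le.1 (hPb i j k)).2, hcb⟩⟩

lemma exists_isGreatest_certFeasible {n : ℕ} (hn : 0 < n) (Q : Matrix (Fin n) (Fin n) ℝ) :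
    ∃ l, IsGreatest (certFeasible Q) l := by
  obtain ⟨l₀, hl₀⟩ := certFeasible_nonempty Q
  have himage : ∀ l ∈ certFeasible Q, l₀ ≤ l → l ∈ Prod.fst '' certParams Q l₀ := by
    rintro l ⟨P, c, hP, hc, H⟩ hl
    exact ⟨(l, P, c), ⟨hl, hP, hc, H⟩, rfl⟩
  obtain ⟨l, ⟨⟨_, P, c⟩, ⟨hl, hP, hc, H⟩, rfl⟩, hmax⟩ :=
    ((isCompact_certParams hn Q l₀).image continuous_fst).exists_isGreatest
      ⟨l₀, himage l₀ hl₀ le_rfl⟩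
  refine ⟨_, ⟨_, _, hP, hc, H⟩, fun l' hl' => ?_⟩
  rcases le_total l₀ l' with h | h
  · exact hmax (himage l' hl' h)
  · exact h.trans hl

end StQP

theorem mainTheorem2 (n : ℕ) (hn : 0 < n) (Q : Matrix (Fin n) (Fin n) ℝ) (hQ : Q.IsSymm) :
    IsGreatest (StQP.parriloFeasible 1 Q) (StQP.parriloBound 1 Q) ∧
    IsGreatest (StQP.cubicFeasible Q) (StQP.cubicBound Q) ∧
    StQP.parriloBound 1 Q = StQP.cubicBound Q := by
  obtain ⟨l, hl⟩ := StQP.exists_isGreatest_certFeasible hn Q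
  rw [StQP.parriloBound, StQP.cubicBound, StQP.parriloFeasible_one_eq hQ,
    StQP.cubicFeasible_eq hn Q, hl.csSup_eq]
  exact ⟨hl, hl, rfl⟩
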